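/- Let $\mathcal V$ be a finite vocabulary with $|\mathcal V|\ge 2$, let $\|\cdot\|$ be any norm on $\mathbb R^d$, and let $\varepsilon>0$, $r>0$, $q\ge 1$. A transformer $\tau$ consists of token embeddings $\mathbf E t\in\mathbb R^d$ ($t\in\mathcal V$), an unembedding matrix $\mathbf F\in\mathbb R^{|\mathcal V|\times d}$ and a stack of layers $\mathrm L$ sending $d\times m$ matrices to $d\times m$ matrices for every $m\ge1$ (nothing else is required of $\mathrm L$). A prompt is a matrix $\mathbf X\in\mathbb R^{d\times m}$, of any length $m\ge 1$, all of whose columns have norm less than $r$. Under greedy decoding $\tau$ generates $\mathbf t=(t_1,\dots,t_n)$ from $\mathbf X$ if, for every $j\le n$, $t_j$ is the index at which the last column of $\mathbf F\,\mathrm L([\mathbf X,\mathbf E t_1,\dots,\mathbf E t_{j-1}])$ is maximal, ties being broken by a fixed but arbitrary rule. Write $\mathrm M(\mathbf X)=\frac1m\sum_{i=1}^m\delta_{\mathbf X_{:,i}}$ and let $W_q(\mu,\nu)=\big(\inf_\pi\int\|x-y\|^q\,d\pi(x,y)\big)^{1/q}$, the infimum being over all couplings $\pi$ of $\mu$ and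 $\nu$; prompts are compared through $W_q(\mathrm M(\mathbf X),\mathrm M(\mathbf Y))$. Put $$K=\Big(e+\frac{e(2r)^q}{\varepsilon^q}\Big)^{(1+4r/\varepsilon)^d}.$$ (a) Call $\mathbf t$ accessible at precision $\varepsilon$ if there is a prompt $\mathbf X$, of some length, such that $\mathbf t$ is generated from every prompt $\mathbf Y$, of any length, with $W_q(\mathrm M(\mathbf X),\mathrm M(\mathbf Y))<\varepsilon$. If $$n>\Big(1+\frac{4r}{\varepsilon}\Big)^d\,\frac{\ln\big(e+e(2r)^q/\varepsilon^q\big)}{\ln|\mathcal V|},$$ then some sequence in $\mathcal V^n$ is not accessible at precision $\varepsilon$. Moreover, for every $n$ the proportion of the sequences in $\mathcal V^n$ that are accessible at precision $\varepsilon$ is at most $K/|\mathcal V|^n$; in particular it is $O(1/|\mathcal V|^n)$ as $n\to\infty$. (b) Suppose that $\tau$ has finite Wasserstein precision $\varepsilon$, that is, there is a finite $\varepsilon$-net $\mathcal G_\varepsilon$ of the set of all prompts under $W_q$, of the smallest possible cardinality, such that each prompt $\mathbf X$ has the same greedy outputs as some element of $\mathcal G_\varepsilon$ that is nearest to $\mathbf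 X$ under $W_q$. Then the conclusions of (a) hold with "accessible" meaning "generated from at least one prompt, of whatever length". -/

import Mathlib

open MeasureTheory Filter
open scoped ENNReal

noncomputable section

/-- A transformer with vocabulary `V` acting on soft prompts, i.e. on finite sequences of vectors of
the embedding space `𝔼` (`ℝ^d` with some norm).  A sequence `[x₁, …, xₘ]` stands for the
`d × m` matrix with these columns.  The stack of layers is an arbitrary length-preserving map, so
attention of any kind, masks, positional encodings and rounding are all allowed. -/
structure Transformer (V 𝔼 : Type*) [AddCommGroup 𝔼] [Module ℝ 𝔼] where
  /-- the embedding matrix, column by column -/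
  embed : V → 𝔼
  /-- the layers `L` -/
  layers : List 𝔼 → List 𝔼
  /-- the layers send an input with `m` columns to an output with `m` columns -/
  length_layers : ∀ X, (layers X).length = X.length
  /-- the unembedding matrix `F` -/
  unembed : 𝔼 →ₗ[ℝ] (V → ℝ)

/-- A greedy decoding rule: it picks a coordinate at which the logits are maximal, ties being broken
in a fixed but arbitrary way. -/
structure GreedyRule (V : Type*) where
  pick : (V → ℝ) → V
  le_pick : ∀ (z : V → ℝ) (v : V), z v ≤ z (pick z)

/-- A soft prompt in the ball of radius `r`: a nonempty sequence of vectors of norm less than `r`. -/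
def IsPrompt {𝔼 : Type*} [NormedAddCommGroup 𝔼] (r : ℝ) (X : List 𝔼) : Prop :=
  X ≠ [] ∧ ∀ x ∈ X, ‖x‖ < r

/-- The empirical measure `M(X) = (1/m) ∑ᵢ δ_{xᵢ}` of a sequence `X` of length `m`. -/
def empirical {𝔼 : Type*} [MeasurableSpace 𝔼] (X : List 𝔼) : Measure 𝔼 :=
  (X.length : ℝ≥0∞)⁻¹ • (X.map fun x => Measure.dirac x).sum

/-- The Wasserstein distance `W_q(μ, ν) = (inf_π ∫ ‖x - y‖^q dπ(x, y))^{1/q}`, the infimum being over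
all couplings `π` of `μ` and `ν`. -/
def wasserstein {𝔼 : Type*} [NormedAddCommGroup 𝔼] [MeasurableSpace 𝔼] (q : ℝ)
    (μ ν : Measure 𝔼) : ℝ≥0∞ :=
  (⨅ (π : Measure (𝔼 × 𝔼)) (_ : π.map Prod.fst = μ ∧ π.map Prod.snd = ν),
    ∫⁻ z, ‖z.1 - z.2‖ₑ ^ q ∂π) ^ (1 / q)

/-- `W_q(M(X), M(Y))`. -/
def promptDist {𝔼 : Type*} [NormedAddCommGroup 𝔼] [MeasurableSpace 𝔼] (q : ℝ)
    (X Y : List 𝔼) : ℝ≥0∞ :=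
  wasserstein q (empirical X) (empirical Y)

namespace Transformer

variable {V 𝔼 : Type*} [NormedAddCommGroup 𝔼] [NormedSpace ℝ 𝔼]

/-- The logits `F L(X)_{:,-1}` of the next token after the nonempty context `X`. -/
def logits (τ : Transformer V 𝔼) (X : List 𝔼) : V → ℝ :=
  τ.unembed ((τ.layers X).getLastD 0)

/-- Under greedy decoding `τ` continues the prompt `X` with the tokens `t₁, …, tₙ`: for every `j`
the token picked after the context `[X, E t₁, …, E t_{j-1}]` is `t_j`. -/
def Generates (τ : Transformer V 𝔼) (g : GreedyRule V) (X : List 𝔼) {n : ℕ} (t : Fin n → V) :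
    Prop :=
  ∀ j : Fin n, g.pick (τ.logits (X ++ ((List.ofFn t).take j).map τ.embed)) = t j

/-- The region `𝓔^m_t` of the soft prompts of length `m` in the ball of radius `r` that lead to the
token sequence `t`. -/
def region (τ : Transformer V 𝔼) (g : GreedyRule V) (r : ℝ) (m : ℕ) {n : ℕ} (t : Fin n → V) :
    Set (List 𝔼) :=
  {X | X.length = m ∧ IsPrompt r X ∧ τ.Generates g X t}

/-- `t` is the greedy output of `τ` on some prompt, of whatever length. -/
def Accessible (τ : Transformer V 𝔼) (g : GreedyRule V) (r : ℝ) {n : ℕ} (t : Fin n → V) : Prop :=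
  ∃ m : ℕ, (τ.region g r m t).Nonempty

variable [MeasurableSpace 𝔼]

/-- `t` is accessible at Wasserstein resolution `ε`: there is a prompt, of whatever length, such
that the whole open `W_q`-ball of radius `ε` around it (in the space of prompts of all lengths)
lies in the regions of `t`. -/
def BallAccessible (τ : Transformer V 𝔼) (g : GreedyRule V) (q ε r : ℝ) {n : ℕ} (t : Fin n → V) :
    Prop :=
  ∃ X : List 𝔼, IsPrompt r X ∧
    ∀ Y : List 𝔼, IsPrompt r Y → promptDist q X Y < ENNReal.ofReal ε →
      Y ∈ τ.region g r Y.length t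

end Transformer

/-- `𝒢` is a finite `ε`-net, under `W_q`, of the prompts in the ball of radius `r`. -/
def IsPromptNet {𝔼 : Type*} [NormedAddCommGroup 𝔼] [MeasurableSpace 𝔼] (q ε r : ℝ)
    (𝒢 : Finset (List 𝔼)) : Prop :=
  (∀ Z ∈ 𝒢, IsPrompt r Z) ∧
    ∀ X : List 𝔼, IsPrompt r X → ∃ Z ∈ 𝒢, promptDist q X Z ≤ ENNReal.ofReal ε

/-- `τ` has finite Wasserstein precision `ε`: for some finite `ε`-net of reference prompts, with no
more elements than needed for an `ε`-net, `τ` does not distinguish a prompt from a reference prompt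
nearest to it, i.e. the two have the same greedy outputs. -/
def Transformer.HasWassersteinPrecision {V 𝔼 : Type*} [NormedAddCommGroup 𝔼] [NormedSpace ℝ 𝔼]
    [MeasurableSpace 𝔼] (τ : Transformer V 𝔼) (g : GreedyRule V) (q ε r : ℝ) : Prop :=
  ∃ 𝒢 : Finset (List 𝔼), IsPromptNet q ε r 𝒢 ∧
    (∀ 𝒢' : Finset (List 𝔼), IsPromptNet q ε r 𝒢' → 𝒢.card ≤ 𝒢'.card) ∧
    ∀ X : List 𝔼, IsPrompt r X →
      ∃ Z ∈ 𝒢, (∀ Z' ∈ 𝒢, promptDist q X Z ≤ promptDist q X Z') ∧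
        ∀ (n : ℕ) (t : Fin n → V), τ.Generates g X t ↔ τ.Generates g Z t

/-- The proportion of the token sequences of length `n` that satisfy `A`. -/
def proportion {V : Type*} [Fintype V] {n : ℕ} (A : (Fin n → V) → Prop) : ℝ :=
  ({t | A t} : Set (Fin n → V)).ncard / (Fintype.card V : ℝ) ^ n

end

/-! Greedy decoding is deterministic, so a set of prompts yields at most as many sequences of a
given length as it has elements. It remains to cover the prompts of all lengths, under `W_q`, by at
most `K` open `ε`-balls. A volume argument gives an `ε/2`-net `S` of the ball with at most `(1 +
4r/ε)^d` points. Moving each column to a nearby point of `S` costs less than `ε^q/2`. Rounding the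
resulting weights to multiples of `1/k` displaces mass at most `|S|/(2k)` over distances below `2r`,
which costs at most `ε^q/2` once `k ≥ |S| (2r)^q/ε^q`. Hence multisets of size `k` in `S` suffice,
whatever the prompt length, and a binomial estimate bounds their number by `K`
(`exists_promptNet_card_le`). In (a), the ball witnessing accessibility contains a net point, which
generates the same sequence. In (b), the given net is of minimal size, hence no larger than this
one. -/

/-! ### Nets of a ball in a normed space. -/

/-- Volume bound for the cardinality of a `δ`-separated subset of an open ball of radius `r`. -/
theorem card_le_of_separated_of_norm_lt {E : Type*} [NormedAddCommGroup E] [NormedSpace ℝ E]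
    [FiniteDimensional ℝ E] {r δ : ℝ} (hr : 0 < r) (hδ : 0 < δ) (s : Finset E)
    (hs : ∀ c ∈ s, ‖c‖ < r) (h : ∀ c ∈ s, ∀ d ∈ s, c ≠ d → δ ≤ ‖c - d‖) :
    (s.card : ℝ) ≤ (1 + 2 * r / δ) ^ Module.finrank ℝ E := by
  borelize E
  let μ : Measure E := Measure.addHaar
  have hδ2 : 0 < δ / 2 := by positivity
  have hρ : 0 < r + δ / 2 := by positivity
  -- Disjoint balls of radius `δ/2` around the points fit into the ball of radius `r + δ/2`; Haar
  -- measure scales with the power `d` of the radius.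
  have hdisj : Set.Pairwise (s : Set E) (Function.onFun Disjoint fun c => Metric.ball c (δ / 2)) := by
    intro c hc d hd hcd
    apply Metric.ball_disjoint_ball
    rw [dist_eq_norm]
    linarith [h c hc d hd hcd]
  have hsub : (⋃ c ∈ s, Metric.ball c (δ / 2)) ⊆ Metric.ball (0 : E) (r + δ / 2) := by
    refine Set.iUnion₂_subset fun x hx => Metric.ball_subset_ball' ?_
    rw [dist_zero_right]
    linarith [hs x hx]
  have hvol : (s.card : ℝ≥0∞) * ENNReal.ofReal ((δ / 2) ^ Module.finrank ℝ E) * μ (Metric.ball 0 1)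
      ≤ ENNReal.ofReal ((r + δ / 2) ^ Module.finrank ℝ E) * μ (Metric.ball 0 1) :=
    calc
      _ = μ (⋃ c ∈ s, Metric.ball c (δ / 2)) := by
        rw [measure_biUnion_finset hdisj fun c _ => measurableSet_ball]
        simp only [μ.addHaar_ball_of_pos _ hδ2, Finset.sum_const, nsmul_eq_mul, mul_assoc]
      _ ≤ μ (Metric.ball (0 : E) (r + δ / 2)) := measure_mono hsub
      _ = _ := by simp only [μ.addHaar_ball_of_pos _ hρ]
  have hle := (ENNReal.mul_le_mul_iff_left (Metric.measure_ball_pos _ _ zero_lt_one).ne'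
    measure_ball_lt_top.ne).1 hvol
  have hreal := ENNReal.toReal_le_of_le_ofReal (by positivity) hle
  rw [ENNReal.toReal_mul, ENNReal.toReal_natCast, ENNReal.toReal_ofReal (by positivity)] at hreal
  have heq : 1 + 2 * r / δ = (r + δ / 2) / (δ / 2) := by field_simp; ring
  rw [heq, div_pow, le_div_iff₀ (by positivity)]
  exact hreal

/-- An open ball of radius `r` has a `δ`-net of at most `(1 + 2r/δ)^d` of its points. -/
theorem exists_finset_net_of_norm_lt {E : Type*} [NormedAddCommGroup E] [NormedSpace ℝ E]
    [FiniteDimensional ℝ E] {r δ : ℝ} (hr : 0 < r) (hδ : 0 < δ) :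
    ∃ s : Finset E, (∀ c ∈ s, ‖c‖ < r) ∧ (s.card : ℝ) ≤ (1 + 2 * r / δ) ^ Module.finrank ℝ E ∧
      ∀ x : E, ‖x‖ < r → ∃ c ∈ s, ‖x - c‖ < δ := by
  classical
  -- A separated set of maximal cardinality is a net: a point far from all its elements could be
  -- added.
  let P : Finset E → Prop := fun s =>
    (∀ c ∈ s, ‖c‖ < r) ∧ ∀ c ∈ s, ∀ d ∈ s, c ≠ d → δ ≤ ‖c - d‖
  let C : Set ℕ := {n | ∃ s, P s ∧ s.card = n}
  have hbdd : BddAbove C := by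
    refine ⟨⌊(1 + 2 * r / δ) ^ Module.finrank ℝ E⌋₊, ?_⟩
    rintro _ ⟨s, hs, rfl⟩
    exact Nat.le_floor (card_le_of_separated_of_norm_lt hr hδ s hs.1 hs.2)
  obtain ⟨s, hs, hcard⟩ := Nat.sSup_mem (s := C) ⟨0, ∅, by simp [P], rfl⟩ hbdd
  refine ⟨s, hs.1, card_le_of_separated_of_norm_lt hr hδ s hs.1 hs.2, fun x hx => ?_⟩
  by_contra! hfar
  have hxs : x ∉ s := fun hmem => by
    have := hfar x hmem
    simp only [sub_self, norm_zero] at this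
    linarith
  have hins : P (insert x s) := by
    refine ⟨?_, ?_⟩
    · intro c hc
      rcases Finset.mem_insert.1 hc with rfl | hc
      exacts [hx, hs.1 c hc]
    · intro c hc d hd hcd
      rcases Finset.mem_insert.1 hc with rfl | hc' <;> rcases Finset.mem_insert.1 hd with rfl | hd'
      · exact absurd rfl hcd
      · exact hfar d hd'
      · rw [norm_sub_rev]; exact hfar c hc'
      · exact hs.2 c hc' d hd' hcd
  have := le_csSup hbdd (show (insert x s).card ∈ C from ⟨_, hins, rfl⟩)
  rw [Finset.card_insert_of_notMem hxs, ← hcard] at this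
  omega

/-! ### Rounding and transport of discrete measures. -/

/-- A probability vector can be rounded to a vector of multiples of `1 / k` at total variation
distance at most `N / (2k)`. -/
theorem exists_nat_rounding {ι : Type*} [Fintype ι] (a : ι → ℝ) (ha : ∀ i, 0 ≤ a i)
    (hsum : ∑ i, a i = 1) (k : ℕ) (hk : 0 < k) :
    ∃ b : ι → ℕ, ∑ i, b i = k ∧
      ∑ i, max (a i - (b i : ℝ) / k) 0 ≤ (Fintype.card ι : ℝ) / (2 * k) := by
  classical
  have hk' : (0 : ℝ) < k := by exact_mod_cast hk
  let f : ι → ℕ := fun i => ⌊k * a i⌋₊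
  have hf : ∀ i, (f i : ℝ) ≤ k * a i := fun i => Nat.floor_le (mul_nonneg hk'.le (ha i))
  have hf' : ∀ i, k * a i < f i + 1 := fun i => Nat.lt_floor_add_one _
  have htot : ∑ i, k * a i = k := by rw [← Finset.mul_sum, hsum, mul_one]
  have hle : ∑ i, f i ≤ k := by
    have : ∑ i, (f i : ℝ) ≤ k := htot ▸ Finset.sum_le_sum fun i _ => hf i
    exact_mod_cast this
  have hge : k ≤ ∑ i, f i + Fintype.card ι := by
    have : (k : ℝ) ≤ ∑ i, ((f i : ℝ) + 1) :=
      htot.symm.le.trans (Finset.sum_le_sum fun i _ => (hf' i).le)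
    rw [Finset.sum_add_distrib] at this
    simp only [Finset.sum_const, Finset.card_univ, nsmul_eq_mul, mul_one] at this
    exact_mod_cast this
  -- Rounding all entries down loses at most one unit per index, so adding one on a suitable set `S`
  -- restores the total `k`.
  obtain ⟨S, -, hS⟩ := Finset.exists_subset_card_eq (s := (Finset.univ : Finset ι))
    (n := k - ∑ i, f i) (by rw [Finset.card_univ]; omega)
  let b : ι → ℕ := fun i => f i + if i ∈ S then 1 else 0
  have hb : ∑ i, b i = k := by
    simp only [b, Finset.sum_add_distrib, Finset.sum_boole, Finset.filter_univ_mem, hS, Nat.cast_id]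
    omega
  have hbR : ∑ i, (b i : ℝ) / k = 1 := by
    rw [← Finset.sum_div, ← Nat.cast_sum, hb, div_self hk'.ne']
  refine ⟨b, hb, ?_⟩
  -- Both vectors have sum 1, so excess and deficit have equal totals; each is half of the `ℓ¹`
  -- distance, whence the factor 2 in `N / (2k)`.
  have hswap : ∑ i, max (a i - (b i : ℝ) / k) 0 = ∑ i, max ((b i : ℝ) / k - a i) 0 := by
    rw [← sub_eq_zero, ← Finset.sum_sub_distrib]
    have : ∀ i, max (a i - (b i : ℝ) / k) 0 - max ((b i : ℝ) / k - a i) 0 = a i - (b i : ℝ) / k := by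
      intro i
      rcases le_total (a i) ((b i : ℝ) / k) with h | h
      · rw [max_eq_right (by linarith), max_eq_left (by linarith)]; ring
      · rw [max_eq_left (by linarith), max_eq_right (by linarith)]; ring
    rw [Finset.sum_congr rfl fun i _ => this i, Finset.sum_sub_distrib, hsum, hbR, sub_self]
  have habs : ∀ i, max (a i - (b i : ℝ) / k) 0 + max ((b i : ℝ) / k - a i) 0 ≤ 1 / k := by
    intro i
    have h1 : a i - (b i : ℝ) / k ≤ 1 / k := by
      rw [sub_le_iff_le_add, ← add_div, le_div_iff₀ hk']
      have : (f i : ℝ) ≤ b i := Nat.cast_le.2 (Nat.le_add_right _ _)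
      linarith [hf' i]
    have h2 : (b i : ℝ) / k - a i ≤ 1 / k := by
      rw [sub_le_iff_le_add, div_le_iff₀ hk', add_mul, one_div, inv_mul_cancel₀ hk'.ne']
      have : (b i : ℝ) ≤ f i + 1 := by
        simp only [b, Nat.cast_add]; gcongr; split_ifs <;> simp
      linarith [hf i]
    have h0 : (0 : ℝ) ≤ 1 / k := by positivity
    rcases le_total (a i) ((b i : ℝ) / k) with h | h
    · rw [max_eq_right (by linarith), max_eq_left (by linarith)]; linarith
    · rw [max_eq_left (by linarith), max_eq_right (by linarith)]; linarith
  have h2 := Finset.sum_le_sum fun i (_ : i ∈ Finset.univ) => habs i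
  rw [Finset.sum_add_distrib, ← hswap, Finset.sum_const, Finset.card_univ, nsmul_eq_mul] at h2
  have : (Fintype.card ι : ℝ) / (2 * k) = (Fintype.card ι * (1 / k)) / 2 := by field_simp
  rw [this]
  linarith

/-- A coupling of the weights `p` on `L` with the weights `β` on `ι` that follows `c : L → ι` except
on a mass given by the excess of the image of `p` over `β`. -/
theorem exists_coupling_weights {L ι : Type*} [Fintype L] [Fintype ι] [DecidableEq ι]
    (p : L → ℝ) (hp : ∀ l, 0 ≤ p l) (c : L → ι) (β : ι → ℝ) (hβ : ∀ i, 0 ≤ β i)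
    (hsum : ∑ l, p l = ∑ i, β i) :
    ∃ w : L → ι → ℝ, (∀ l i, 0 ≤ w l i) ∧ (∀ l, ∑ i, w l i = p l) ∧ (∀ i, ∑ l, w l i = β i) ∧
      ∀ (D : L → ι → ℝ) (B : ℝ), (∀ l i, 0 ≤ D l i) → (∀ l i, D l i ≤ B) →
        ∑ l, ∑ i, w l i * D l i ≤ ∑ l, p l * D l (c l) +
          (∑ i, max ((∑ l with c l = i, p l) - β i) 0) * B := by
  let a : ι → ℝ := fun i => ∑ l with c l = i, p l
  have ha : ∀ i, 0 ≤ a i := fun i => Finset.sum_nonneg fun l _ => hp l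
  have hpa : ∀ l, p l ≤ a (c l) := fun l =>
    Finset.single_le_sum (f := p) (fun l _ => hp l) (by simp)
  have hfiber : ∀ g : ι → ℝ, ∑ l, p l * g (c l) = ∑ i, a i * g i := by
    intro g
    rw [← Finset.sum_fiberwise Finset.univ c]
    refine Finset.sum_congr rfl fun i _ => ?_
    rw [Finset.sum_mul]
    refine Finset.sum_congr rfl fun l hl => ?_
    rw [(Finset.mem_filter.1 hl).2]
  have hsa : ∑ i, a i = ∑ i, β i := by
    rw [← hsum]; exact Finset.sum_fiberwise Finset.univ c p
  let e : ι → ℝ := fun i => max (a i - β i) 0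
  let f : ι → ℝ := fun i => max (β i - a i) 0
  have he : ∀ i, 0 ≤ e i := fun i => le_max_right _ _
  have hf : ∀ i, 0 ≤ f i := fun i => le_max_right _ _
  have hef : ∀ i, e i - f i = a i - β i := by
    intro i
    simp only [e, f]
    rcases le_total (a i) (β i) with h | h
    · rw [max_eq_right (by linarith), max_eq_left (by linarith)]; ring
    · rw [max_eq_left (by linarith), max_eq_right (by linarith)]; ring
  have hmin : ∀ i, min (a i) (β i) = a i - e i := by
    intro i
    simp only [e]
    rcases le_total (a i) (β i) with h | h
    · rw [max_eq_right (by linarith), min_eq_left h]; ring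
    · rw [max_eq_left (by linarith), min_eq_right h]; ring
  have hea : ∀ i, e i ≤ a i := fun i => by
    have := le_min (ha i) (hβ i); rw [hmin] at this; linarith
  let T : ℝ := ∑ i, e i
  have hT0 : 0 ≤ T := Finset.sum_nonneg fun i _ => he i
  have hTf : ∑ i, f i = T := by
    have : ∑ i, (e i - f i) = 0 := by
      rw [Finset.sum_congr rfl fun i _ => hef i, Finset.sum_sub_distrib, hsa, sub_self]
    rw [Finset.sum_sub_distrib] at this
    linarith
  -- A vanishing denominator is harmless: it forces the numerator to vanish too. The same applies to
  -- `a` and `T` below.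
  have haq : ∀ i, a i * (e i / a i) = e i := by
    intro i
    rcases (ha i).eq_or_lt with h | h
    · have := hea i; have := he i; rw [← h]; linarith
    · field_simp
  have hpc : ∀ l, p l * (a (c l) / a (c l)) = p l := by
    intro l
    rcases (ha (c l)).eq_or_lt with h | h
    · have := hpa l; have := hp l; rw [← h]; linarith
    · rw [div_self h.ne', mul_one]
  have heT : ∀ i, e i * (T / T) = e i := by
    intro i
    rcases hT0.eq_or_lt with h | h
    · have : e i ≤ T := Finset.single_le_sum (f := e) (fun i _ => he i) (Finset.mem_univ i)
      have := he i; rw [← h]; linarith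
    · rw [div_self h.ne', mul_one]
  have hfT : ∀ i, f i * (T / T) = f i := by
    intro i
    rcases hT0.eq_or_lt with h | h
    · have : f i ≤ T := hTf ▸ Finset.single_le_sum (f := f) (fun i _ => hf i) (Finset.mem_univ i)
      have := hf i; rw [← h]; linarith
    · rw [div_self h.ne', mul_one]
  let s : L → ℝ := fun l => p l * (e (c l) / a (c l))
  have hs0 : ∀ l, 0 ≤ s l := fun l => mul_nonneg (hp l) (div_nonneg (he _) (ha _))
  have hsp : ∀ l, s l ≤ p l := fun l =>
    mul_le_of_le_one_right (hp l) (div_le_one_of_le₀ (hea _) (ha _))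
  have hsT : ∑ l, s l = T := by
    rw [show ∑ l, s l = _ from hfiber fun i => e i / a i]
    exact Finset.sum_congr rfl fun i _ => haq i
  have hrow : ∀ l, ∑ i, s l * (f i / T) = s l := by
    intro l
    rw [← Finset.mul_sum, ← Finset.sum_div, hTf]
    have := heT (c l)
    simp only [s]
    rw [mul_assoc, div_mul_eq_mul_div, this]
  -- Each `l` gives up the share `s l` of its mass proportional to the excess of its cell `c l`; the
  -- rest stays in that cell. The released mass, `T` in total, is spread in proportion to the
  -- deficits `f`.
  refine ⟨fun l i => (if i = c l then p l - s l else 0) + s l * (f i / T), ?_, ?_, ?_, ?_⟩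
  · intro l i
    refine add_nonneg ?_ (mul_nonneg (hs0 l) (div_nonneg (hf i) hT0))
    split_ifs
    exacts [sub_nonneg.2 (hsp l), le_rfl]
  · intro l
    rw [Finset.sum_add_distrib, hrow]
    simp
  · intro i
    rw [Finset.sum_add_distrib, ← Finset.sum_mul, hsT, mul_div_left_comm, hfT]
    have hdiag : ∑ l, (if i = c l then p l - s l else 0) = a i - e i := by
      have : ∀ l, (if i = c l then p l - s l else 0) =
          p l * (if i = c l then 1 - e i / a i else 0) := by
        intro l
        split_ifs with h
        · simp only [s, h]; ring
        · simp
      rw [Finset.sum_congr rfl fun l _ => this l,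
        hfiber fun j => if i = j then 1 - e i / a i else 0]
      simp only [mul_ite, mul_zero, Finset.sum_ite_eq, Finset.mem_univ, if_true]
      rw [mul_sub, mul_one, haq]
    rw [hdiag]
    linarith [hef i]
  · intro D B hD0 hDB
    have hterm : ∀ l, ∑ i, ((if i = c l then p l - s l else 0) + s l * (f i / T)) * D l i ≤
        p l * D l (c l) + s l * B := by
      intro l
      simp only [add_mul, ite_mul, zero_mul, Finset.sum_add_distrib, Finset.sum_ite_eq',
        Finset.mem_univ, if_true]
      have h1 : ∑ i, s l * (f i / T) * D l i ≤ ∑ i, s l * (f i / T) * B :=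
        Finset.sum_le_sum fun i _ => mul_le_mul_of_nonneg_left (hDB l i)
          (mul_nonneg (hs0 l) (div_nonneg (hf i) hT0))
      rw [← Finset.sum_mul, hrow] at h1
      have h2 := mul_nonneg (hs0 l) (hD0 l (c l))
      linarith
    refine (Finset.sum_le_sum fun l _ => hterm l).trans_eq ?_
    rw [Finset.sum_add_distrib, ← Finset.sum_mul, hsT]

/-- A matrix of weights bounds the Wasserstein distance of the discrete measures given by its row
and column sums. -/
theorem wasserstein_sum_dirac_le {𝔼 L ι : Type*} [NormedAddCommGroup 𝔼] [MeasurableSpace 𝔼]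
    [MeasurableSingletonClass 𝔼] [Fintype L] [Fintype ι] {q : ℝ} (hq : 0 < q)
    (x : L → 𝔼) (z : ι → 𝔼) (w : L → ι → ℝ) (hw : ∀ l i, 0 ≤ w l i) :
    wasserstein q (∑ l, ENNReal.ofReal (∑ i, w l i) • Measure.dirac (x l))
      (∑ i, ENNReal.ofReal (∑ l, w l i) • Measure.dirac (z i)) ≤
      ENNReal.ofReal (∑ l, ∑ i, w l i * ‖x l - z i‖ ^ q) ^ (1 / q) := by
  unfold wasserstein
  refine ENNReal.rpow_le_rpow ?_ (by positivity)
  let π : Measure (𝔼 × 𝔼) :=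
    ∑ y : L × ι, ENNReal.ofReal (w y.1 y.2) • Measure.dirac (x y.1, z y.2)
  have hfst : π.map Prod.fst = ∑ l, ENNReal.ofReal (∑ i, w l i) • Measure.dirac (x l) := by
    rw [← Measure.mapₗ_apply_of_measurable measurable_fst, map_sum, Fintype.sum_prod_type]
    refine Finset.sum_congr rfl fun l _ => ?_
    rw [ENNReal.ofReal_sum_of_nonneg fun i _ => hw l i, Finset.sum_smul]
    refine Finset.sum_congr rfl fun i _ => ?_
    rw [map_smul, Measure.mapₗ_apply_of_measurable measurable_fst, Measure.map_dirac' measurable_fst]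
  have hsnd : π.map Prod.snd = ∑ i, ENNReal.ofReal (∑ l, w l i) • Measure.dirac (z i) := by
    rw [← Measure.mapₗ_apply_of_measurable measurable_snd, map_sum, Fintype.sum_prod_type_right]
    refine Finset.sum_congr rfl fun i _ => ?_
    rw [ENNReal.ofReal_sum_of_nonneg fun l _ => hw l i, Finset.sum_smul]
    refine Finset.sum_congr rfl fun l _ => ?_
    rw [map_smul, Measure.mapₗ_apply_of_measurable measurable_snd, Measure.map_dirac' measurable_snd]
  refine (iInf₂_le π ⟨hfst, hsnd⟩).trans_eq ?_
  simp only [π]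
  rw [lintegral_finsetSum_measure, Fintype.sum_prod_type,
    ENNReal.ofReal_sum_of_nonneg fun l _ => Finset.sum_nonneg fun i _ =>
      mul_nonneg (hw l i) (Real.rpow_nonneg (norm_nonneg _) q)]
  refine Finset.sum_congr rfl fun l _ => ?_
  rw [ENNReal.ofReal_sum_of_nonneg fun i _ =>
      mul_nonneg (hw l i) (Real.rpow_nonneg (norm_nonneg _) q)]
  refine Finset.sum_congr rfl fun i _ => ?_
  rw [lintegral_smul_measure, lintegral_dirac, ENNReal.ofReal_mul (hw l i), smul_eq_mul,
    ← ENNReal.ofReal_rpow_of_nonneg (norm_nonneg _) hq.le, ofReal_norm]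

/-- The empirical measure as a sum over positions. -/
theorem empirical_eq_sum_get {𝔼 : Type*} [MeasurableSpace 𝔼] (X : List 𝔼) :
    empirical X = ∑ l : Fin X.length, (X.length : ℝ≥0∞)⁻¹ • Measure.dirac (X.get l) := by
  unfold empirical
  rw [← Finset.smul_sum]
  congr 1
  rw [← List.sum_ofFn]
  congr 1
  conv_lhs => rw [← List.ofFn_get X, List.map_ofFn]
  rfl

/-- The empirical measure of a sequence of values of `z` as a sum over the indices. -/
theorem empirical_map_eq_sum {𝔼 ι : Type*} [MeasurableSpace 𝔼] [Fintype ι] [DecidableEq ι]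
    (z : ι → 𝔼) (s : List ι) :
    empirical (s.map z) =
      ∑ i, ((s.length : ℝ≥0∞)⁻¹ * (s.count i : ℝ≥0∞)) • Measure.dirac (z i) := by
  unfold empirical
  simp only [mul_smul]
  rw [← Finset.smul_sum, List.length_map, List.map_map]
  congr 1
  rw [Finset.sum_list_map_count]
  rw [Finset.sum_subset (Finset.subset_univ s.toFinset)]
  · simp [Nat.cast_smul_eq_nsmul]
  · intro i _ hi
    rw [List.count_eq_zero_of_not_mem (by simpa using hi), zero_smul]

/-! ### Covering number of the space of prompts. -/

/-- The number of multisets of size `k` in `N` elements is at most `(e (1 + A))^N` if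
`k ≤ N A + 1`. -/
theorem choose_multiset_le_exp_mul_pow {N k : ℕ} (hN : 0 < N) (hk : 0 < k) {A : ℝ}
    (hkA : (k : ℝ) ≤ N * A + 1) :
    ((N + k - 1).choose k : ℝ) ≤ (Real.exp 1 * (1 + A)) ^ N := by
  obtain ⟨n, rfl⟩ : ∃ n, N = n + 1 := ⟨N - 1, by omega⟩
  obtain ⟨j, rfl⟩ : ∃ j, k = j + 1 := ⟨k - 1, by omega⟩
  have hM : n + 1 + (j + 1) - 1 = n + (j + 1) := by omega
  rw [hM, Nat.choose_symm_add.symm]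
  set M : ℝ := ((n + (j + 1) : ℕ) : ℝ) with hMdef
  have hnM : ((n + 1 : ℕ) : ℝ) ≤ M := by rw [hMdef]; exact_mod_cast (by omega)
  have hn : (0 : ℝ) < ((n + 1 : ℕ) : ℝ) := by positivity
  -- Here `M = N + k - 1`, and the `-1` absorbs the `+1` allowed for rounding `k` up.
  have hMA : M / ((n + 1 : ℕ) : ℝ) ≤ 1 + A := by
    rw [div_le_iff₀ hn, hMdef]
    push_cast at hkA ⊢
    linarith
  have hM0 : 0 ≤ M := hn.le.trans hnM
  -- Since `N ≤ M`, the bound `M^(N-1)/(N-1)!` is at most `M^N/N!`; then `N^N/N! ≤ e^N`.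
  calc (((n + (j + 1)).choose n : ℕ) : ℝ) ≤ M ^ n / (n.factorial : ℝ) :=
        Nat.choose_le_pow_div n (n + (j + 1))
    _ = ((n + 1 : ℕ) : ℝ) * M ^ n / ((n + 1).factorial : ℝ) := by
        rw [Nat.factorial_succ, Nat.cast_mul, mul_div_mul_left _ _ hn.ne']
    _ ≤ M * M ^ n / ((n + 1).factorial : ℝ) := by gcongr
    _ = (M / ((n + 1 : ℕ) : ℝ)) ^ (n + 1) *
          (((n + 1 : ℕ) : ℝ) ^ (n + 1) / ((n + 1).factorial : ℝ)) := by
        rw [div_pow, ← pow_succ']; field_simp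
    _ ≤ (1 + A) ^ (n + 1) * Real.exp ((n + 1 : ℕ) : ℝ) := by
        have hA : 0 ≤ 1 + A := (div_nonneg hM0 hn.le).trans hMA
        gcongr
        exact Real.pow_div_factorial_le_exp _ hn.le _
    _ = (Real.exp 1 * (1 + A)) ^ (n + 1) := by
        rw [mul_pow, Real.exp_one_pow, mul_comm]

/-- If the values of `z` form an `ε / 2`-net of the ball, every prompt is at distance less than `ε`
from some sequence of `k` values of `z`. -/
theorem exists_multiset_promptDist_lt {𝔼 ι : Type*} [NormedAddCommGroup 𝔼] [MeasurableSpace 𝔼]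
    [BorelSpace 𝔼] [Fintype ι] {q ε r : ℝ} (hq : 1 ≤ q) (hε : 0 < ε) (hr : 0 < r)
    (z : ι → 𝔼) (hz : ∀ i, ‖z i‖ < r) (hnet : ∀ x : 𝔼, ‖x‖ < r → ∃ i, ‖x - z i‖ < ε / 2)
    {k : ℕ} (hk : 0 < k) (hkN : Fintype.card ι * ((2 * r) ^ q / ε ^ q) ≤ k)
    (X : List 𝔼) (hX : IsPrompt r X) :
    ∃ s : Multiset ι, s.card = k ∧ promptDist q X (s.toList.map z) < ENNReal.ofReal ε := by
  classical
  have hq0 : 0 < q := by linarith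
  have hk' : (0 : ℝ) < k := by exact_mod_cast hk
  have hm : 0 < X.length := List.length_pos_iff.2 hX.1
  have hm' : (0 : ℝ) < X.length := by exact_mod_cast hm
  have hnorm : ∀ l : Fin X.length, ‖X.get l‖ < r := fun l => hX.2 _ (List.get_mem X l)
  choose c hc using fun l => hnet (X.get l) (hnorm l)
  let p : Fin X.length → ℝ := fun _ => (X.length : ℝ)⁻¹
  have hp0 : ∀ l, 0 < p l := fun _ => inv_pos.2 hm'
  have hp1 : ∑ l, p l = 1 := by simp [p, hm'.ne']
  obtain ⟨b, hbk, hbTV⟩ := exists_nat_rounding (fun i => ∑ l with c l = i, p l)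
    (fun i => Finset.sum_nonneg fun l _ => (hp0 l).le)
    ((Finset.sum_fiberwise Finset.univ c p).trans hp1) k hk
  have hβ1 : ∑ i, (b i : ℝ) / k = 1 := by
    rw [← Finset.sum_div, ← Nat.cast_sum, hbk, div_self hk'.ne']
  obtain ⟨w, hw0, hrow, hcol, hcost⟩ := exists_coupling_weights p (fun l => (hp0 l).le) c
    (fun i => (b i : ℝ) / k) (fun i => by positivity) (hp1.trans hβ1.symm)
  let s : Multiset ι := ∑ i, Multiset.replicate (b i) i
  have hcard : s.card = k := by simp [s, Multiset.card_sum, hbk]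
  have hcount : ∀ i, s.toList.count i = b i := by
    intro i
    rw [← Multiset.coe_count, Multiset.coe_toList]
    simp [s, Multiset.count_sum', Multiset.count_replicate]
  refine ⟨s, hcard, ?_⟩
  have hXm : empirical X = ∑ l, ENNReal.ofReal (∑ i, w l i) • Measure.dirac (X.get l) := by
    rw [empirical_eq_sum_get]
    refine Finset.sum_congr rfl fun l _ => ?_
    rw [hrow, ENNReal.ofReal_inv_of_pos hm', ENNReal.ofReal_natCast]
  have hZm : empirical (s.toList.map z) =
      ∑ i, ENNReal.ofReal (∑ l, w l i) • Measure.dirac (z i) := by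
    rw [empirical_map_eq_sum]
    refine Finset.sum_congr rfl fun i _ => ?_
    rw [hcol, hcount, Multiset.length_toList, hcard, ENNReal.ofReal_div_of_pos hk',
      ENNReal.ofReal_natCast, ENNReal.ofReal_natCast, div_eq_mul_inv, mul_comm]
  -- This is where `q ≥ 1` enters.
  have hhalf : (ε / 2) ^ q ≤ ε ^ q / 2 := by
    rw [Real.div_rpow hε.le zero_le_two]
    have : (2 : ℝ) ≤ 2 ^ q := by
      simpa using Real.rpow_le_rpow_of_exponent_le one_le_two hq
    gcongr
  have hεq : 0 < ε ^ q := Real.rpow_pos_of_pos hε q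
  have hBpos : 0 < (2 * r) ^ q := Real.rpow_pos_of_pos (by positivity) q
  -- Strictness here gives distance less than `ε`, as the open balls in (a) require.
  have hdiag : ∑ l, p l * ‖X.get l - z (c l)‖ ^ q < ε ^ q / 2 := by
    calc _ < ∑ l, p l * (ε / 2) ^ q := by
          refine Finset.sum_lt_sum_of_nonempty ⟨⟨0, hm⟩, Finset.mem_univ _⟩ fun l _ => ?_
          exact mul_lt_mul_of_pos_left
            (Real.rpow_lt_rpow (norm_nonneg _) (hc l) hq0) (hp0 l)
      _ = (ε / 2) ^ q := by rw [← Finset.sum_mul, hp1, one_mul]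
      _ ≤ _ := hhalf
  have hoff : (Fintype.card ι : ℝ) / (2 * k) * (2 * r) ^ q ≤ ε ^ q / 2 := by
    rw [← mul_div_assoc, div_le_iff₀ hεq] at hkN
    rw [div_mul_eq_mul_div, div_le_iff₀ (by positivity)]
    linarith
  have hcost' := hcost (fun l i => ‖X.get l - z i‖ ^ q) ((2 * r) ^ q)
    (fun l i => Real.rpow_nonneg (norm_nonneg _) q)
    (fun l i => Real.rpow_le_rpow (norm_nonneg _)
      ((norm_sub_le _ _).trans (by linarith [hnorm l, hz i])) hq0.le)
  have htotal : ∑ l, ∑ i, w l i * ‖X.get l - z i‖ ^ q < ε ^ q := by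
    have := mul_le_mul_of_nonneg_right hbTV hBpos.le
    linarith
  unfold promptDist
  rw [hXm, hZm]
  refine (wasserstein_sum_dirac_le hq0 X.get z w hw0).trans_lt ?_
  calc _ < ENNReal.ofReal (ε ^ q) ^ (1 / q) :=
        ENNReal.rpow_lt_rpow ((ENNReal.ofReal_lt_ofReal_iff hεq).2 htotal) (by positivity)
    _ = ENNReal.ofReal ε := by
        rw [← ENNReal.ofReal_rpow_of_pos hε, ← ENNReal.rpow_mul, mul_one_div_cancel hq0.ne',
          ENNReal.rpow_one]

/-- Covering number bound for the prompts under the Wasserstein distance, with open balls. -/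
theorem exists_promptNet_card_le {𝔼 : Type*} [NormedAddCommGroup 𝔼] [NormedSpace ℝ 𝔼]
    [FiniteDimensional ℝ 𝔼] [MeasurableSpace 𝔼] [BorelSpace 𝔼] {q ε r : ℝ} (hq : 1 ≤ q)
    (hε : 0 < ε) (hr : 0 < r) :
    ∃ 𝒢 : Finset (List 𝔼), (∀ Z ∈ 𝒢, IsPrompt r Z) ∧
      (∀ X : List 𝔼, IsPrompt r X → ∃ Z ∈ 𝒢, promptDist q X Z < ENNReal.ofReal ε) ∧
      (𝒢.card : ℝ) ≤ (Real.exp 1 + Real.exp 1 * (2 * r) ^ q / ε ^ q) ^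
        ((1 + 4 * r / ε) ^ Module.finrank ℝ 𝔼) := by
  classical
  obtain ⟨S, hSr, hScard, hSnet⟩ := exists_finset_net_of_norm_lt (E := 𝔼) hr (half_pos hε)
  have hSne : 0 < S.card := by
    obtain ⟨c, hc, -⟩ := hSnet 0 (by simpa using hr)
    exact Finset.card_pos.2 ⟨c, hc⟩
  have hSne' : (0 : ℝ) < S.card := by exact_mod_cast hSne
  set A : ℝ := (2 * r) ^ q / ε ^ q with hA
  have hApos : 0 < A := by positivity
  let k : ℕ := ⌈S.card * A⌉₊
  have hk : 0 < k := Nat.ceil_pos.2 (mul_pos hSne' hApos)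
  let toPrompt : Sym S k → List 𝔼 := fun s => s.1.toList.map Subtype.val
  refine ⟨Finset.univ.image toPrompt, ?_, ?_, ?_⟩
  · intro Z hZ
    obtain ⟨s, -, rfl⟩ := Finset.mem_image.1 hZ
    refine ⟨fun h => ?_, fun x hx => ?_⟩
    · have := congrArg List.length h
      simp only [toPrompt, List.length_map, Multiset.length_toList, s.2, List.length_nil] at this
      omega
    · obtain ⟨y, -, rfl⟩ := List.mem_map.1 hx
      exact hSr _ y.2
  · intro X hX
    obtain ⟨s, hs, hdist⟩ := exists_multiset_promptDist_lt (k := k) hq hε hr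
      (Subtype.val : S → 𝔼) (fun y => hSr _ y.2)
      (fun x hx => by
        obtain ⟨y, hy, hxy⟩ := hSnet x hx
        exact ⟨⟨y, hy⟩, hxy⟩)
      hk (by rw [Fintype.card_coe]; exact Nat.le_ceil _) X hX
    exact ⟨toPrompt ⟨s, hs⟩, Finset.mem_image_of_mem _ (Finset.mem_univ _), hdist⟩
  · have hcard : (Finset.univ.image toPrompt).card ≤ (S.card + k - 1).choose k := by
      refine Finset.card_image_le.trans_eq ?_
      rw [Finset.card_univ, Sym.card_sym_eq_choose, Fintype.card_coe]
    have hbase : Real.exp 1 + Real.exp 1 * (2 * r) ^ q / ε ^ q = Real.exp 1 * (1 + A) := by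
      rw [hA]; ring
    -- A base at least 1 allows `S.card` to be replaced by its upper bound in the exponent.
    have hone : 1 ≤ Real.exp 1 * (1 + A) :=
      one_le_mul_of_one_le_of_one_le (Real.one_le_exp zero_le_one) (by linarith)
    have hexp : 1 + 2 * r / (ε / 2) = 1 + 4 * r / ε := by ring
    calc ((Finset.univ.image toPrompt).card : ℝ) ≤ ((S.card + k - 1).choose k : ℝ) := by
          exact_mod_cast hcard
      _ ≤ (Real.exp 1 * (1 + A)) ^ S.card :=
          choose_multiset_le_exp_mul_pow hSne hk (Nat.ceil_lt_add_one (by positivity)).le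
      _ = (Real.exp 1 * (1 + A)) ^ (S.card : ℝ) := (Real.rpow_natCast _ _).symm
      _ ≤ _ := by
          rw [hbase, ← hexp]
          exact Real.rpow_le_rpow_of_exponent_le hone hScard

/-! ### Counting greedy outputs. -/

/-- A prompt generates at most one token sequence of each length. -/
theorem Transformer.Generates.unique {V 𝔼 : Type*} [NormedAddCommGroup 𝔼] [NormedSpace ℝ 𝔼]
    {τ : Transformer V 𝔼} {g : GreedyRule V} {X : List 𝔼} {n : ℕ} {t u : Fin n → V}
    (ht : τ.Generates g X t) (hu : τ.Generates g X u) : t = u := by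
  -- The context that determines token `j` involves only the earlier tokens.
  have key : ∀ j : ℕ, ∀ hj : j < n, t ⟨j, hj⟩ = u ⟨j, hj⟩ := by
    intro j
    induction j using Nat.strong_induction_on with
    | _ j ih =>
      intro hj
      rw [← ht ⟨j, hj⟩, ← hu ⟨j, hj⟩]
      have : (List.ofFn t).take j = (List.ofFn u).take j := by
        apply List.ext_getElem
        · simp
        · intro i h1 h2
          simp only [List.length_take, List.length_ofFn] at h1
          simp only [List.getElem_take, List.getElem_ofFn]
          exact ih i (by omega) (by omega)
      simp only [this]
  exact funext fun j => key j j.2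

/-- If every sequence satisfying `A` is generated from a prompt in `𝒢`, at most `|𝒢|` sequences
satisfy `A`. -/
theorem Transformer.ncard_le_of_generates {V 𝔼 : Type*} [NormedAddCommGroup 𝔼]
    [NormedSpace ℝ 𝔼] (τ : Transformer V 𝔼) (g : GreedyRule V) (𝒢 : Finset (List 𝔼)) {n : ℕ}
    (A : (Fin n → V) → Prop) (hA : ∀ t, A t → ∃ Z ∈ 𝒢, τ.Generates g Z t) :
    ({t | A t} : Set (Fin n → V)).ncard ≤ 𝒢.card := by
  choose! F hF hgen using hA
  rw [← Set.ncard_coe_finset]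
  refine Set.ncard_le_ncard_of_injOn F (fun t ht => hF t ht) ?_ 𝒢.finite_toSet
  intro t ht u hu h
  exact (hgen t ht).unique (h ▸ hgen u hu)

/-- If the number of sequences satisfying `A` is at most `B ^ D` for every length, then from some
length on they are not all sequences, and their proportion decays exponentially. -/
theorem proportion_bounds_of_ncard_le {V : Type*} [Fintype V] (hV : 2 ≤ Fintype.card V)
    (A : ∀ {n : ℕ}, (Fin n → V) → Prop) {B D : ℝ} (hB : 0 < B)
    (h : ∀ n, (({t | A t} : Set (Fin n → V)).ncard : ℝ) ≤ B ^ D) :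
    (∀ n : ℕ, D * Real.log B / Real.log (Fintype.card V) < n → ∃ t : Fin n → V, ¬ A t) ∧
    (∀ n : ℕ, proportion (fun t : Fin n → V => A t) ≤ B ^ D / (Fintype.card V : ℝ) ^ n) ∧
    (fun n : ℕ => proportion (fun t : Fin n → V => A t))
      =O[Filter.atTop] (fun n : ℕ => 1 / (Fintype.card V : ℝ) ^ n) := by
  have hV1 : (1 : ℝ) < Fintype.card V := by exact_mod_cast (by omega : 1 < Fintype.card V)
  have hV0 : (0 : ℝ) < Fintype.card V := by linarith
  have hprop : ∀ n : ℕ, proportion (fun t : Fin n → V => A t) ≤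
      B ^ D / (Fintype.card V : ℝ) ^ n := fun n =>
    div_le_div_of_nonneg_right (h n) (by positivity)
  refine ⟨fun n hn => ?_, hprop, ?_⟩
  · by_contra! hall
    -- The threshold on `n` says exactly that `B ^ D < |V| ^ n`.
    rw [div_lt_iff₀ (Real.log_pos hV1), ← Real.log_rpow hB, ← Real.log_pow] at hn
    have hlt := (Real.log_lt_log_iff (Real.rpow_pos_of_pos hB D) (by positivity)).1 hn
    have huniv : ({t | A t} : Set (Fin n → V)) = Set.univ := Set.eq_univ_of_forall hall
    have hle := h n
    rw [huniv, Set.ncard_univ, Nat.card_eq_fintype_card, Fintype.card_fun, Fintype.card_fin,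
      Nat.cast_pow] at hle
    linarith
  · refine Asymptotics.IsBigO.of_bound (B ^ D) (Eventually.of_forall fun n => ?_)
    have h0 : 0 ≤ proportion (fun t : Fin n → V => A t) :=
      div_nonneg (Nat.cast_nonneg _) (by positivity)
    rw [Real.norm_of_nonneg h0, Real.norm_of_nonneg (by positivity), mul_one_div]
    exact hprop n

theorem mainTheorem4 {V 𝔼 : Type*} [Fintype V]
    [NormedAddCommGroup 𝔼] [NormedSpace ℝ 𝔼] [FiniteDimensional ℝ 𝔼]
    [MeasurableSpace 𝔼] [BorelSpace 𝔼]
    (d : ℕ) (hd : Module.finrank ℝ 𝔼 = d) (hV : 2 ≤ Fintype.card V)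
    (τ : Transformer V 𝔼) (g : GreedyRule V)
    (q ε r : ℝ) (hq : 1 ≤ q) (hε : 0 < ε) (hr : 0 < r) :
    ((∀ n : ℕ, (1 + 4 * r / ε) ^ d * Real.log (Real.exp 1 + Real.exp 1 * (2 * r) ^ q / ε ^ q)
            / Real.log (Fintype.card V) < n →
          ∃ t : Fin n → V, ¬ τ.BallAccessible g q ε r t) ∧
      (∀ n : ℕ, proportion (fun t : Fin n → V => τ.BallAccessible g q ε r t) ≤
          (Real.exp 1 + Real.exp 1 * (2 * r) ^ q / ε ^ q) ^ ((1 + 4 * r / ε) ^ d)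
            / (Fintype.card V : ℝ) ^ n) ∧
      (fun n : ℕ => proportion (fun t : Fin n → V => τ.BallAccessible g q ε r t))
        =O[Filter.atTop] (fun n : ℕ => 1 / (Fintype.card V : ℝ) ^ n)) ∧
    (τ.HasWassersteinPrecision g q ε r →
      (∀ n : ℕ, (1 + 4 * r / ε) ^ d * Real.log (Real.exp 1 + Real.exp 1 * (2 * r) ^ q / ε ^ q)
            / Real.log (Fintype.card V) < n →
          ∃ t : Fin n → V, ¬ τ.Accessible g r t) ∧
      (∀ n : ℕ, proportion (fun t : Fin n → V => τ.Accessible g r t) ≤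
          (Real.exp 1 + Real.exp 1 * (2 * r) ^ q / ε ^ q) ^ ((1 + 4 * r / ε) ^ d)
            / (Fintype.card V : ℝ) ^ n) ∧
      (fun n : ℕ => proportion (fun t : Fin n → V => τ.Accessible g r t))
        =O[Filter.atTop] (fun n : ℕ => 1 / (Fintype.card V : ℝ) ^ n)) := by
  subst hd
  obtain ⟨𝒢, hprompt, hnet, hcard⟩ := exists_promptNet_card_le (𝔼 := 𝔼) hq hε hr
  have hB : 0 < Real.exp 1 + Real.exp 1 * (2 * r) ^ q / ε ^ q := by positivity
  refine ⟨proportion_bounds_of_ncard_le hV (fun t => τ.BallAccessible g q ε r t) hB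
    fun n => ?_, ?_⟩
  · refine le_trans (Nat.cast_le.2 (τ.ncard_le_of_generates g 𝒢 _ ?_)) hcard
    rintro t ⟨X, hX, hball⟩
    obtain ⟨Z, hZ, hXZ⟩ := hnet X hX
    exact ⟨Z, hZ, (hball Z (hprompt Z hZ) hXZ).2.2⟩
  · rintro ⟨𝒢', -, hmin, hprec⟩
    refine proportion_bounds_of_ncard_le hV (fun t => τ.Accessible g r t) hB fun n => ?_
    -- The net built above competes in the minimality of `𝒢'`, so its cardinality bound passes to
    -- `𝒢'`.
    have hle := hmin 𝒢 ⟨hprompt, fun X hX => by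
      obtain ⟨Z, hZ, hXZ⟩ := hnet X hX
      exact ⟨Z, hZ, hXZ.le⟩⟩
    refine le_trans (Nat.cast_le.2 ((τ.ncard_le_of_generates g 𝒢' _ ?_).trans hle)) hcard
    rintro t ⟨m, X, -, hX, hgen⟩
    obtain ⟨Z, hZ, -, hsame⟩ := hprec X hX
    exact ⟨Z, hZ, (hsame n t).1 hgen⟩
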